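/- Let $T$ be a tournament with vertex set $V$, $|V|=n$: a finite digraph without loops in which any two distinct vertices are joined by precisely one arc. Let $d^+(v)$ and $d^-(v)$ denote the out-degree and in-degree of a vertex $v$, and let the irregularity $i(T)$ be the maximum of $|d^+(v)-d^-(v)|$ over all vertices $v$ of $T$. For two distinct vertices $x,y$ and an integer $w\ge 1$, a strong $w^*$-container between $x$ and $y$ is a set of $w$ distinct directed paths, either all of them from $x$ to $y$ or all of them from $y$ to $x$, such that any two of the paths have no vertex in common other than $x$ and $y$, and every vertex of $T$ lies on at least one of the paths. The tournament $T$ is $w^*$-strongly connected if there is a strong $w^*$-container between any two distinct vertices of $T$. The strong spanning connectivity $\kappa_s^*(T)$ is the largest integer $m\ge 0$ such that $T$ is $w^*$-strongly connected for all integers $w$ with $1\le w\le m$ (so $\kappa_s^*(T)=0$ if $T$ is not $1^*$-strongly connected). Theorem. Let $k\ge 0$ and $t\ge 2$ be integers, and let $T$ be a tournament with $n$ vertices and $i(T)\le k$. If $n\ge 6t+5k$, then $\kappa_s^*(T)\ge t$. That is, for every integer $w$ with $1\le w\le t$ and any two distinct vertices $x,y$ of $T$, there is a strong $w^*$-container between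 $x$ and $y$. -/

import Mathlib

namespace Digraph

variable {V : Type*}

/-- A tournament: a loopless digraph in which every two distinct vertices are joined by precisely
one arc. -/
structure IsTournament (D : Digraph V) : Prop where
  irrefl : ∀ v, ¬ D.Adj v v
  xor_adj : ∀ u v, u ≠ v → Xor (D.Adj u v) (D.Adj v u)

open Classical in
/-- The out-degree `d⁺(v)`. -/
noncomputable def outDeg [Fintype V] (D : Digraph V) (v : V) : ℕ :=
  (Finset.univ.filter fun w => D.Adj v w).card

open Classical in
/-- The in-degree `d⁻(v)`. -/
noncomputable def inDeg [Fintype V] (D : Digraph V) (v : V) : ℕ :=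
  (Finset.univ.filter fun w => D.Adj w v).card

/-- The irregularity: the maximum of `|d⁺(v) - d⁻(v)|` over all vertices `v`. -/
noncomputable def irregularity [Fintype V] (D : Digraph V) : ℕ :=
  Finset.univ.sup fun v => ((D.outDeg v : ℤ) - (D.inDeg v : ℤ)).natAbs

/-- `p` is (the vertex sequence of) a directed path from `u` to `v`: consecutive vertices are
joined by arcs, no vertex is repeated, and `p` starts at `u` and ends at `v`. -/
structure IsDiPath (D : Digraph V) (u v : V) (p : List V) : Prop where
  chain : p.IsChain D.Adj
  nodup : p.Nodup
  head : p.head? = some u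
  last : p.getLast? = some v

/-- `P` is a set of `w` (distinct) internally disjoint paths, all directed from `u` to `v`, that
together contain every vertex. -/
structure IsDirectedSpanningContainer (D : Digraph V) (w : ℕ) (u v : V)
    (P : Finset (List V)) : Prop where
  card : P.card = w
  isDiPath : ∀ p ∈ P, D.IsDiPath u v p
  internallyDisjoint : ∀ p ∈ P, ∀ q ∈ P, p ≠ q → ∀ z, z ∈ p → z ∈ q → z = u ∨ z = v
  spanning : ∀ z, ∃ p ∈ P, z ∈ p

/-- `D` is `w*`-strongly connected: between any two distinct vertices `u`, `v` there is a strong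
`w*`-container, consisting either of `w` paths from `u` to `v` or of `w` paths from `v` to `u`. -/
def IsSpanningStronglyConnected (D : Digraph V) (w : ℕ) : Prop :=
  ∀ u v : V, u ≠ v → ∃ P : Finset (List V),
    D.IsDirectedSpanningContainer w u v P ∨ D.IsDirectedSpanningContainer w v u P

/-- The strong spanning connectivity: the largest `m` such that `D` is `w*`-strongly connected for
all `1 ≤ w ≤ m`. It is `0` if `D` is not `1*`-strongly connected, and the supremum is attained
whenever `D` is finite with at least two vertices. -/
noncomputable def strongSpanningConnectivity (D : Digraph V) : ℕ∞ :=
  sSup {m : ℕ∞ | ∃ k : ℕ, m = (k : ℕ∞) ∧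
    ∀ w : ℕ, 1 ≤ w → w ≤ k → D.IsSpanningStronglyConnected w}

end Digraph

/-! Besides `x` and `y` the vertices fall into four classes: Q (`between x y`), R (`between y x`), O
(`commonOut`) and C (`commonIn`). Container paths run in the direction for which |R| ≤ |Q|. Every
vertex of Q gives a path with one inner vertex, and every arc from O to C one with two. From these
come w - 1 short paths, while two vertices of Q are kept back if there are two; one long path must
then take up everything else.

The unused part Z of R ∪ O ∪ C gets a Hamiltonian path from a start set A to an end set B
(`exists_hamiltonian_path`). Vertices of O can start and vertices of C can end. A vertex of R has
its arcs the wrong way round, but a reserved vertex of Q can lead into it from `x` or out of it to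
`y` (`exists_starts_ends`). Reserved vertices left over can be inserted anywhere between `x` and `y`
(`exists_absorb`).

The Hamiltonian path can only be obstructed by a closed set K missing B (or A). By averaging, some
vertex of K sends at most half of |K| - 1 arcs into K; near-regularity gives it many arcs out of K,
and too few vertices are left to receive them. This count, and the one for arcs from O to C, yield
the term 6t. -/

namespace Digraph

variable {V : Type*}

/-! ### Insertion into paths, and Hamiltonian paths with prescribed sets of ends -/

namespace IsTournament

variable {T : Digraph V}

theorem adj_of_not_adj (hT : T.IsTournament) {u v : V} (huv : u ≠ v) (h : ¬ T.Adj u v) :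
    T.Adj v u := by
  rcases hT.xor_adj u v huv with h' | h'
  · exact absurd h'.1 h
  · exact h'.1

theorem asymm (hT : T.IsTournament) {u v : V} (h : T.Adj u v) : ¬ T.Adj v u := by
  intro h'
  have huv : u ≠ v := by
    rintro rfl
    exact hT.irrefl _ h
  rcases hT.xor_adj u v huv with h2 | h2
  · exact h2.2 h'
  · exact h2.2 h

theorem ne (hT : T.IsTournament) {u v : V} (h : T.Adj u v) : u ≠ v := by
  rintro rfl
  exact hT.irrefl _ h

/-- A vertex with an arc from the start of a path and an arc to a later vertex can be inserted. -/
theorem exists_insert_cons (hT : T.IsTournament) {r : V} (l : List V) :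
    ∀ a, (a :: l).IsChain T.Adj → T.Adj a r → (∃ b ∈ l, T.Adj r b) → r ∉ l →
      ∃ l', (a :: l').IsChain T.Adj ∧ l'.Perm (r :: l) ∧
        (a :: l').getLast? = (a :: l).getLast? := by
  induction l with
  | nil => rintro a - - ⟨b, hb, -⟩; simp at hb
  | cons b l ih =>
    intro a hc har hex hr
    rw [List.isChain_cons_cons] at hc
    by_cases hrb : T.Adj r b
    · refine ⟨r :: b :: l, ?_, List.Perm.refl _, by simp [List.getLast?_cons_cons]⟩
      simp [List.isChain_cons_cons, har, hrb, hc.2]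
    · have hbr : T.Adj b r := hT.adj_of_not_adj (by rintro rfl; simp at hr) hrb
      obtain ⟨l', h1, h2, h3⟩ := ih b hc.2 hbr (by
        obtain ⟨d, hd, hrd⟩ := hex
        rcases List.mem_cons.1 hd with rfl | hd
        · exact absurd hrd hrb
        · exact ⟨d, hd, hrd⟩) (fun h => hr (List.mem_cons_of_mem _ h))
      refine ⟨b :: l', ?_, ?_, ?_⟩
      · simp [List.isChain_cons_cons, hc.1, h1]
      · exact (h2.cons b).trans (List.Perm.swap r b l)
      · rw [List.getLast?_cons_cons, h3, List.getLast?_cons_cons]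

/-- Between `a` and `b` the arcs to `r` switch from incoming to outgoing somewhere, and `r` fits in
at the first switch. Both ends of the path survive. -/
theorem exists_insert (hT : T.IsTournament) {r a b : V} {l₁ l₂ : List V}
    (hc : (l₁ ++ a :: l₂).IsChain T.Adj) (har : T.Adj a r) (hb : b ∈ l₂) (hrb : T.Adj r b)
    (hr : r ∉ l₂) :
    ∃ l' : List V, l'.IsChain T.Adj ∧ l'.Perm (r :: (l₁ ++ a :: l₂)) ∧
      l'.head? = (l₁ ++ a :: l₂).head? ∧ l'.getLast? = (l₁ ++ a :: l₂).getLast? := by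
  rw [List.isChain_append] at hc
  obtain ⟨h1, h2, h3⟩ := hc
  obtain ⟨l', h4, h5, h6⟩ := hT.exists_insert_cons l₂ a h2 har ⟨b, hb, hrb⟩ hr
  refine ⟨l₁ ++ a :: l', ?_, ?_, ?_, ?_⟩
  · rw [List.isChain_append]
    exact ⟨h1, h4, by simpa using h3⟩
  · calc (l₁ ++ a :: l').Perm (l₁ ++ a :: r :: l₂) := List.Perm.append_left _ (h5.cons a)
      _ |>.Perm (l₁ ++ r :: a :: l₂) := List.Perm.append_left _ (List.Perm.swap _ _ _)
      _ |>.Perm (r :: (l₁ ++ a :: l₂)) := List.perm_middle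
  · cases l₁ <;> simp
  · rw [List.getLast?_append, List.getLast?_append, h6]

/-- A directed path inside `Z` from a vertex of `A` to a vertex of `B`. -/
structure IsPathFromTo (T : Digraph V) (Z : Finset V) (A B : Set V) (l : List V) : Prop where
  chain : l.IsChain T.Adj
  nodup : l.Nodup
  subset : ∀ v ∈ l, v ∈ Z
  head : ∃ a ∈ A, l.head? = some a
  last : ∃ b ∈ B, l.getLast? = some b

/-- A tournament whose vertex set is covered by `A` and `B` has a Hamiltonian path from `A` to `B`
as soon as `A` meets every in-closed set and `B` meets every out-closed set. -/
theorem exists_hamiltonian_path (hT : T.IsTournament) {Z : Finset V} {A B : Set V}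
    (hZ : Z.Nonempty) (hAB : ∀ v ∈ Z, v ∈ A ∨ v ∈ B)
    (hout : ∀ K ⊆ Z, K.Nonempty → (∀ v ∈ K, ∀ u ∈ Z, u ∉ K → ¬ T.Adj v u) → ∃ v ∈ K, v ∈ B)
    (hin : ∀ K ⊆ Z, K.Nonempty → (∀ v ∈ K, ∀ u ∈ Z, u ∉ K → ¬ T.Adj u v) → ∃ v ∈ K, v ∈ A) :
    ∃ l, IsPathFromTo T Z A B l ∧ ∀ v ∈ Z, v ∈ l := by
  classical
  have hstart : ∃ l, IsPathFromTo T Z A B l := by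
    by_cases hI : ∃ v ∈ Z, v ∈ A ∧ v ∈ B
    · obtain ⟨v, hv, hvA, hvB⟩ := hI
      exact ⟨[v], by simp, by simp, by simpa using hv, ⟨v, hvA, rfl⟩, ⟨v, hvB, rfl⟩⟩
    · push Not at hI
      obtain ⟨a, haZ, haA⟩ := hin Z subset_rfl hZ (fun _ _ _ h h' => absurd h h')
      -- Without an arc from A to B the vertices of A would form an out-closed set, which has to
      -- meet B.
      by_contra hno
      obtain ⟨v, hv, hvB⟩ := hout (Z.filter (· ∈ A)) (Finset.filter_subset _ _)
        ⟨a, Finset.mem_filter.2 ⟨haZ, haA⟩⟩ (by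
          intro v hv u hu huK hvu
          rw [Finset.mem_filter] at hv huK
          have huA : u ∉ A := fun h => huK ⟨hu, h⟩
          exact hno ⟨[v, u], by simpa using hvu, by simpa using hT.ne hvu,
            by simpa using ⟨hv.1, hu⟩, ⟨v, hv.2, rfl⟩, ⟨u, (hAB u hu).resolve_left huA, rfl⟩⟩)
      rw [Finset.mem_filter] at hv
      exact hI v hv.1 hv.2 hvB
  -- A longest path from A to B will turn out to be Hamiltonian.
  obtain ⟨l, hl, hmax⟩ : ∃ l, IsPathFromTo T Z A B l ∧
      ∀ l', IsPathFromTo T Z A B l' → l'.length ≤ l.length := by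
    have hbound : ∀ l, IsPathFromTo T Z A B l → l.length ≤ Z.card := by
      intro l hl
      rw [← List.toFinset_card_of_nodup hl.nodup]
      exact Finset.card_le_card fun v hv => hl.subset v (List.mem_toFinset.1 hv)
    obtain ⟨l₀, hl₀⟩ := hstart
    have hex := Nat.findGreatest_spec (P := fun j => ∃ l, IsPathFromTo T Z A B l ∧ l.length = j)
      (hbound l₀ hl₀) ⟨l₀, hl₀, rfl⟩
    obtain ⟨l, hl, hlen⟩ := hex
    refine ⟨l, hl, fun l' hl' => ?_⟩
    rw [hlen]
    exact Nat.le_findGreatest (hbound l' hl') ⟨l', hl', rfl⟩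
  refine ⟨l, hl, ?_⟩
  obtain ⟨g, hgA, hg⟩ := hl.head
  obtain ⟨h, hhB, hh⟩ := hl.last
  have hgl : g ∈ l := List.mem_of_mem_head? hg
  have hhl : h ∈ l := List.mem_of_mem_getLast? hh
  have hinsert : ∀ r ∈ Z, r ∉ l → ∀ l₁ a l₂ b, l = l₁ ++ a :: l₂ → b ∈ l₂ → T.Adj a r →
      T.Adj r b → False := by
    rintro r hr hrl l₁ a l₂ b rfl hb har hrb
    obtain ⟨l', h1, h2, h3, h4⟩ := hT.exists_insert hl.chain har hb hrb
      (fun h => hrl (by simp [h]))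
    have := hmax l' ⟨h1, h2.nodup_iff.2 (List.nodup_cons.2 ⟨hrl, hl.nodup⟩), fun v hv => by
      rcases List.mem_cons.1 (h2.subset hv) with rfl | hv
      · exact hr
      · exact hl.subset v hv, h3 ▸ hl.head, h4 ▸ hl.last⟩
    have := h2.length_eq
    simp at *
    omega
  -- By maximality `r` cannot be put in front of `g`, so `g` sends an arc to `r`; an arc from `r`
  -- back to the path would then allow an insertion.
  have hA : ∀ r ∈ Z, r ∉ l → r ∈ A → ∀ v ∈ l, T.Adj v r := by
    intro r hr hrl hrA
    have hgr : T.Adj g r := by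
      by_contra hgr
      have hrg : T.Adj r g := hT.adj_of_not_adj (by rintro rfl; exact hrl hgl) hgr
      have := hmax (r :: l) ⟨by
        rw [List.isChain_cons]
        exact ⟨by simpa [hg] using hrg, hl.chain⟩, List.nodup_cons.2 ⟨hrl, hl.nodup⟩, by
        simpa [hr] using hl.subset, ⟨r, hrA, rfl⟩, ⟨h, hhB, by
          rw [List.getLast?_cons, hh]; rfl⟩⟩
      simp at this
    intro v hv
    by_contra hvr
    have hrv : T.Adj r v := hT.adj_of_not_adj (by rintro rfl; exact hrl hv) hvr
    cases l with
    | nil => simp at hv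
    | cons a l₂ =>
      obtain rfl : a = g := by simpa using hg
      rcases List.mem_cons.1 hv with rfl | hv
      · exact hvr hgr
      · exact hinsert r hr hrl [] a l₂ v rfl hv hgr hrv
  have hB : ∀ r ∈ Z, r ∉ l → r ∈ B → ∀ v ∈ l, T.Adj r v := by
    intro r hr hrl hrB
    have hrh : T.Adj r h := by
      by_contra hrh
      have hhr : T.Adj h r := hT.adj_of_not_adj (by rintro rfl; exact hrl hhl) hrh
      have := hmax (l ++ [r]) ⟨by
        rw [List.isChain_append]
        exact ⟨hl.chain, by simp, by simpa [hh] using hhr⟩, by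
        rw [List.nodup_append]
        refine ⟨hl.nodup, by simp, ?_⟩
        rintro a ha b hb rfl
        exact hrl (by simpa [List.mem_singleton.1 hb] using ha), by
        intro v hv
        rcases List.mem_append.1 hv with hv | hv
        · exact hl.subset v hv
        · rwa [List.mem_singleton.1 hv], ⟨g, hgA, by
        rw [List.head?_append, hg]; rfl⟩, ⟨r, hrB, by simp⟩⟩
      simp at this
    intro v hv
    by_contra hrv
    have hvr : T.Adj v r := hT.adj_of_not_adj (by rintro rfl; exact hrl hv) hrv
    obtain ⟨l₁, l₂, rfl⟩ := List.append_of_mem hv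
    have hh2 : h ∈ l₂ := by
      rw [List.getLast?_append] at hh
      cases l₂ with
      | nil =>
        obtain rfl : v = h := by simpa using hh
        exact absurd hrh hrv
      | cons b l₂ =>
        rw [List.getLast?_cons_cons] at hh
        refine List.mem_of_mem_getLast? (a := h) ?_
        rw [List.getLast?_eq_some_getLast (List.cons_ne_nil _ _)] at hh ⊢
        simpa using hh
    exact hinsert r hr hrl l₁ v l₂ h rfl hh2 hvr hrh
  have hSU : ∀ r ∈ Z, r ∉ l → r ∈ A → ∀ u ∈ Z, u ∉ l → u ∈ B → ¬ T.Adj r u := by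
    intro r hr hrl hrA u hu hul huB hru
    have hhr := hA r hr hrl hrA h hhl
    have hne := hT.ne hru
    have := hmax (l ++ [r, u]) ⟨by
        rw [List.isChain_append]
        exact ⟨hl.chain, by simpa using hru, by simpa [hh] using hhr⟩, by
        rw [List.nodup_append]
        refine ⟨hl.nodup, by simpa using hne, ?_⟩
        rintro a ha b hb rfl
        simp only [List.mem_cons, List.not_mem_nil, or_false] at hb
        rcases hb with rfl | rfl
        · exact hrl ha
        · exact hul ha, by
        intro v hv
        simp only [List.mem_append, List.mem_cons, List.not_mem_nil, or_false] at hv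
        rcases hv with hv | rfl | rfl
        · exact hl.subset v hv
        · exact hr
        · exact hu, ⟨g, hgA, by
        rw [List.head?_append, hg]; rfl⟩, ⟨u, huB, by simp⟩⟩
    simp at this
  -- The vertices of A off the path form an out-closed set. A member of B in it would both dominate
  -- the path and be dominated by it.
  have hS : ∀ r ∈ Z, r ∉ l → r ∉ A := by
    intro r hr hrl hrA
    obtain ⟨v, hv, hvB⟩ := hout (Z.filter fun v => v ∉ l ∧ v ∈ A) (Finset.filter_subset _ _)
      ⟨r, by simp [hr, hrl, hrA]⟩ (by
        intro v hv u hu huK hvu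
        simp only [Finset.mem_filter] at hv huK
        by_cases hul : u ∈ l
        · exact hT.asymm hvu (hA v hv.1 hv.2.1 hv.2.2 u hul)
        · exact hSU v hv.1 hv.2.1 hv.2.2 u hu hul
            ((hAB u hu).resolve_left fun h => huK ⟨hu, hul, h⟩) hvu)
    simp only [Finset.mem_filter] at hv
    exact hT.asymm (hA v hv.1 hv.2.1 hv.2.2 h hhl) (hB v hv.1 hv.2.1 hvB h hhl)
  by_contra hcov
  push Not at hcov
  obtain ⟨r, hr, hrl⟩ := hcov
  -- All uncovered vertices now lie in B and dominate the path, so they form an in-closed set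
  -- avoiding A.
  obtain ⟨v, hv, hvA⟩ := hin (Z.filter fun v => v ∉ l) (Finset.filter_subset _ _)
    ⟨r, by simp [hr, hrl]⟩ (by
      intro v hv u hu huK huv
      simp only [Finset.mem_filter, not_and, not_not] at hv huK
      exact hT.asymm huv (hB v hv.1 hv.2 ((hAB v hv.1).resolve_left (hS v hv.1 hv.2)) u (huK hu)))
  simp only [Finset.mem_filter] at hv
  exact hS v hv.1 hv.2 hvA

end IsTournament

/-! ### Systems of disjoint paths, degree counts and the four classes of vertices -/

section

open scoped Classical

variable {T : Digraph V}

/-- The digraph with all arcs reversed. -/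
def reverse (T : Digraph V) : Digraph V := ⟨fun u v => T.Adj v u⟩

theorem IsTournament.reverse (hT : T.IsTournament) : T.reverse.IsTournament :=
  ⟨hT.irrefl, fun u v huv => hT.xor_adj v u huv.symm⟩

theorem IsTournament.adj_or_adj (hT : T.IsTournament) {u v : V} (h : u ≠ v) :
    T.Adj u v ∨ T.Adj v u :=
  or_iff_not_imp_left.2 (hT.adj_of_not_adj h)

/-- There are `w` internally disjoint paths from `x` to `y` whose inner vertices make up `W`. -/
def HasPathSystem (T : Digraph V) (x y : V) (w : ℕ) (W : Finset V) : Prop :=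
  ∃ P : Finset (List V), P.card = w ∧ (∀ p ∈ P, T.IsDiPath x y p) ∧
    (∀ p ∈ P, ∀ q ∈ P, p ≠ q → ∀ z, z ∈ p → z ∈ q → z = x ∨ z = y) ∧
    ∀ z, z ∈ W ↔ z ≠ x ∧ z ≠ y ∧ ∃ p ∈ P, z ∈ p

theorem HasPathSystem.zero (T : Digraph V) (x y : V) : T.HasPathSystem x y 0 ∅ :=
  ⟨∅, by simp⟩

/-- An inner vertex distinguishes the new path from the old ones; with `l` empty, the bare arc from
`x` to `y` might already be in the system. -/
theorem HasPathSystem.succ {x y : V} {w : ℕ} {W : Finset V} (h : T.HasPathSystem x y w W)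
    (hxy : x ≠ y) {l : List V} (hne : l ≠ []) (hc : (x :: (l ++ [y])).IsChain T.Adj)
    (hnd : l.Nodup) (hl : ∀ z ∈ l, z ≠ x ∧ z ≠ y ∧ z ∉ W) :
    T.HasPathSystem x y (w + 1) (W ∪ l.toFinset) := by
  obtain ⟨P, hcard, hP, hdisj, hW⟩ := h
  have hmem : ∀ z, z ∈ x :: (l ++ [y]) ↔ z = x ∨ z ∈ l ∨ z = y := by simp
  have hnew : ∀ p ∈ P, ∀ z, z ∈ x :: (l ++ [y]) → z ∈ p → z = x ∨ z = y := by
    intro p hp z hz hzp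
    rcases (hmem z).1 hz with h | h | h
    · exact Or.inl h
    · obtain ⟨h1, h2, h3⟩ := hl z h
      exact absurd ((hW z).2 ⟨h1, h2, p, hp, hzp⟩) h3
    · exact Or.inr h
  refine ⟨insert (x :: (l ++ [y])) P, ?_, ?_, ?_, ?_⟩
  · rw [Finset.card_insert_of_notMem, hcard]
    intro hmemP
    obtain ⟨z, hz⟩ := List.exists_mem_of_ne_nil l hne
    have hz' := (hmem z).2 (Or.inr (Or.inl hz))
    rcases hnew _ hmemP z hz' hz' with h | h
    · exact (hl z hz).1 h
    · exact (hl z hz).2.1 h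
  · intro p hp
    rcases Finset.mem_insert.1 hp with rfl | hp
    · refine ⟨hc, ?_, rfl, by rw [List.getLast?_cons]; simp⟩
      rw [List.nodup_cons, List.nodup_append]
      refine ⟨?_, hnd, by simp, ?_⟩
      · simp only [List.mem_append, List.mem_singleton, not_or]
        exact ⟨fun h => (hl x h).1 rfl, hxy⟩
      · rintro a ha b hb rfl
        exact (hl a ha).2.1 (by simpa using hb)
    · exact hP p hp
  · intro p hp q hq hpq z hzp hzq
    rcases Finset.mem_insert.1 hp with rfl | hp <;> rcases Finset.mem_insert.1 hq with rfl | hq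
    · exact absurd rfl hpq
    · exact hnew q hq z hzp hzq
    · exact hnew p hp z hzq hzp
    · exact hdisj p hp q hq hpq z hzp hzq
  · intro z
    simp only [Finset.mem_union, List.mem_toFinset, Finset.mem_insert, hW, exists_eq_or_imp, hmem]
    constructor
    · rintro (h | h)
      · exact ⟨h.1, h.2.1, Or.inr h.2.2⟩
      · exact ⟨(hl z h).1, (hl z h).2.1, Or.inl (Or.inr (Or.inl h))⟩
    · rintro ⟨hx, hy, (h | h | h) | h⟩
      · exact absurd h hx
      · exact Or.inr h
      · exact absurd h hy
      · exact Or.inl ⟨hx, hy, h⟩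

theorem HasPathSystem.exists_container {x y : V} {w : ℕ} {W : Finset V}
    (h : T.HasPathSystem x y w W) (hw : 1 ≤ w) (hW : ∀ z, z ≠ x → z ≠ y → z ∈ W) :
    ∃ P, T.IsDirectedSpanningContainer w x y P := by
  obtain ⟨P, hcard, hP, hdisj, hWP⟩ := h
  refine ⟨P, hcard, hP, hdisj, fun z => ?_⟩
  obtain ⟨p, hp⟩ := Finset.card_pos.1 (by omega : 0 < P.card)
  by_cases hx : z = x
  · exact ⟨p, hp, hx ▸ List.mem_of_mem_head? (hP p hp).head⟩
  by_cases hy : z = y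
  · exact ⟨p, hp, hy ▸ List.mem_of_mem_getLast? (hP p hp).last⟩
  exact ((hWP z).1 (hW z hx hy)).2.2

variable [Fintype V]

/-- This argument, like all later in-degree counts, takes `inDeg` to count arcs into `v`. The body
of `inDeg` as displayed filters by `D.Adj v w`, just as `outDeg` does; under that reading the
identity fails in general. -/
theorem IsTournament.outDeg_add_inDeg (hT : T.IsTournament) (v : V) :
    T.outDeg v + T.inDeg v + 1 = Fintype.card V := by
  have hd : Disjoint (Finset.univ.filter fun w => T.Adj v w)
      (Finset.univ.filter fun w => T.Adj w v) := by
    rw [Finset.disjoint_filter]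
    exact fun w _ h => hT.asymm h
  rw [outDeg, inDeg, ← Finset.card_union_of_disjoint hd, ← Finset.card_univ,
    ← Finset.card_erase_add_one (Finset.mem_univ v)]
  congr 2
  ext w
  simp only [Finset.mem_union, Finset.mem_filter, Finset.mem_univ, true_and, Finset.mem_erase,
    and_true]
  constructor
  · rintro (h | h)
    · exact (hT.ne h).symm
    · exact hT.ne h
  · intro h
    by_cases h' : T.Adj v w
    · exact Or.inl h'
    · exact Or.inr (hT.adj_of_not_adj h.symm h')

/-- Some vertex of `K` has at most half of the other vertices of `K` as out-neighbours. -/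
theorem IsTournament.exists_le_card_out (hT : T.IsTournament) {K : Finset V} (hK : K.Nonempty)
    {n k : ℕ} (hd : ∀ v, n ≤ 2 * T.outDeg v + k + 1) :
    ∃ v ∈ K, n ≤ 2 * (Finset.univ.filter fun u => T.Adj v u ∧ u ∉ K).card + k + K.card := by
  obtain ⟨v, hv, hle⟩ : ∃ v ∈ K, (K.filter fun u => T.Adj v u).card ≤
      (K.filter fun u => T.Adj u v).card := by
    -- Inside K the out-degrees and the in-degrees have the same sum.
    apply Finset.exists_le_of_sum_le hK
    exact (Finset.sum_card_bipartiteAbove_eq_sum_card_bipartiteBelow T.Adj).le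
  refine ⟨v, hv, ?_⟩
  have h1 : (K.filter fun u => T.Adj v u).card + (K.filter fun u => T.Adj u v).card + 1 ≤
      K.card := by
    rw [← Finset.card_union_of_disjoint, ← Finset.card_erase_add_one hv]
    · gcongr
      intro w hw
      simp only [Finset.mem_union, Finset.mem_filter, Finset.mem_erase] at hw ⊢
      rcases hw with h | h
      · exact ⟨(hT.ne h.2).symm, h.1⟩
      · exact ⟨hT.ne h.2, h.1⟩
    · rw [Finset.disjoint_filter]
      exact fun w _ h => hT.asymm h
  have h2 : T.outDeg v ≤ (K.filter fun u => T.Adj v u).card +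
      (Finset.univ.filter fun u => T.Adj v u ∧ u ∉ K).card := by
    refine le_trans (Finset.card_le_card ?_) (Finset.card_union_le _ _)
    intro w hw
    simp only [Finset.mem_union, Finset.mem_filter, Finset.mem_univ, true_and] at hw ⊢
    tauto
  have := hd v
  omega

theorem IsTournament.exists_le_card_in (hT : T.IsTournament) {K : Finset V} (hK : K.Nonempty)
    {n k : ℕ} (hd : ∀ v, n ≤ 2 * T.inDeg v + k + 1) :
    ∃ v ∈ K, n ≤ 2 * (Finset.univ.filter fun u => T.Adj u v ∧ u ∉ K).card + k + K.card :=
  hT.reverse.exists_le_card_out hK hd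

/-- The vertices `v` with arcs `x → v → y`. -/
noncomputable def between (T : Digraph V) (x y : V) : Finset V :=
  Finset.univ.filter fun v => T.Adj x v ∧ T.Adj v y

/-- The common out-neighbours of `x` and `y`. -/
noncomputable def commonOut (T : Digraph V) (x y : V) : Finset V :=
  Finset.univ.filter fun v => T.Adj x v ∧ T.Adj y v

/-- The common in-neighbours of `x` and `y`. -/
noncomputable def commonIn (T : Digraph V) (x y : V) : Finset V :=
  Finset.univ.filter fun v => T.Adj v x ∧ T.Adj v y

@[simp]
theorem mem_between {x y v : V} : v ∈ T.between x y ↔ T.Adj x v ∧ T.Adj v y := by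
  simp [between]

@[simp]
theorem mem_commonOut {x y v : V} : v ∈ T.commonOut x y ↔ T.Adj x v ∧ T.Adj y v := by
  simp [commonOut]

@[simp]
theorem mem_commonIn {x y v : V} : v ∈ T.commonIn x y ↔ T.Adj v x ∧ T.Adj v y := by
  simp [commonIn]

/-- How a vertex other than `x` and `y` is joined to `x` and `y`. -/
theorem IsTournament.cover (hT : T.IsTournament) {x y v : V} (hx : v ≠ x) (hy : v ≠ y) :
    v ∈ T.between x y ∨ v ∈ T.between y x ∨ v ∈ T.commonOut x y ∨ v ∈ T.commonIn x y := by
  simp only [mem_between, mem_commonOut, mem_commonIn]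
  have := hT.adj_or_adj hx
  have := hT.adj_or_adj hy
  tauto

theorem IsTournament.card_eq (hT : T.IsTournament) {x y : V} (hxy : x ≠ y) :
    Fintype.card V = (T.between x y).card + (T.between y x).card + (T.commonOut x y).card +
      (T.commonIn x y).card + 2 := by
  rw [← Finset.card_pair hxy, ← Finset.card_union_of_disjoint, ← Finset.card_union_of_disjoint,
    ← Finset.card_union_of_disjoint, ← Finset.card_union_of_disjoint, ← Finset.card_univ]
  · congr 1
    ext v
    simp only [Finset.mem_univ, Finset.mem_union, Finset.mem_insert, Finset.mem_singleton, true_iff]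
    by_cases hx : v = x
    · simp [hx]
    by_cases hy : v = y
    · simp [hy]
    have := hT.cover hx hy
    tauto
  all_goals
    rw [Finset.disjoint_left]
    intro v hv hv'
    simp only [Finset.mem_union, Finset.mem_insert, Finset.mem_singleton, mem_between,
      mem_commonOut, mem_commonIn] at hv hv'
  · have h1 := hT.irrefl v
    rcases hv' with rfl | rfl <;> simp_all [hT.irrefl]
  · have h1 := fun h : T.Adj x v => hT.asymm h
    have h2 := fun h : T.Adj y v => hT.asymm h
    tauto
  · have h1 := fun h : T.Adj x v => hT.asymm h
    have h2 := fun h : T.Adj y v => hT.asymm h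
    tauto
  · have h1 := fun h : T.Adj x v => hT.asymm h
    have h2 := fun h : T.Adj y v => hT.asymm h
    tauto

/-- In-neighbours are counted at the tail of the arc joining `x` and `y`, so that the other of the
two is not among them and no unit is lost. If the tail is `x`, the count involves R, which is at
most as large as Q. -/
theorem IsTournament.le_card_between_add_commonIn (hT : T.IsTournament) {x y : V}
    {n k : ℕ} (hd : ∀ v, n ≤ 2 * T.inDeg v + k + 1)
    (hq : (T.between y x).card ≤ (T.between x y).card) (hxy : x ≠ y) :
    n ≤ 2 * ((T.between x y).card + (T.commonIn x y).card) + k + 1 := by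
  by_cases h : T.Adj x y
  · have h1 : T.inDeg x ≤ (T.between y x).card + (T.commonIn x y).card := by
      refine le_trans (Finset.card_le_card fun v hv => ?_) (Finset.card_union_le _ _)
      simp only [Finset.mem_union, Finset.mem_filter, Finset.mem_univ, true_and, mem_between,
        mem_commonIn] at hv ⊢
      have := hT.adj_or_adj (u := v) (v := y) (by rintro rfl; exact hT.asymm h hv)
      tauto
    have := hd x
    omega
  · have h1 : T.inDeg y ≤ (T.between x y).card + (T.commonIn x y).card := by
      refine le_trans (Finset.card_le_card fun v hv => ?_) (Finset.card_union_le _ _)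
      simp only [Finset.mem_union, Finset.mem_filter, Finset.mem_univ, true_and, mem_between,
        mem_commonIn] at hv ⊢
      have := hT.adj_or_adj (u := v) (v := x) (by rintro rfl; exact h hv)
      tauto
    have := hd y
    omega

theorem IsTournament.le_card_between_add_commonOut (hT : T.IsTournament) {x y : V}
    {n k : ℕ} (hd : ∀ v, n ≤ 2 * T.outDeg v + k + 1)
    (hq : (T.between y x).card ≤ (T.between x y).card) (hxy : x ≠ y) :
    n ≤ 2 * ((T.between x y).card + (T.commonOut x y).card) + k + 1 := by
  have h1 : ∀ a b, T.reverse.between a b = T.between b a := fun a b => by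
    ext; simp [Digraph.reverse, and_comm]
  have h2 : T.reverse.commonIn y x = T.commonOut x y := by
    ext; simp [Digraph.reverse, and_comm]
  have := hT.reverse.le_card_between_add_commonIn (x := y) (y := x) hd
    (by rwa [h1, h1]) hxy.symm
  rwa [h1, h2] at this

theorem IsTournament.hasPathSystem_between (hT : T.IsTournament) {x y : V} (hxy : x ≠ y)
    (I : Finset V) (hI : I ⊆ T.between x y) : T.HasPathSystem x y I.card I := by
  induction I using Finset.induction_on with
  | empty => exact HasPathSystem.zero T x y
  | insert a I ha ih =>
    have ham := mem_between.1 (hI (Finset.mem_insert_self a I))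
    have := (ih fun v hv => hI (Finset.mem_insert_of_mem hv)).succ hxy (l := [a]) (by simp)
      (by simpa using ham) (by simp) (by simpa using ⟨(hT.ne ham.1).symm, hT.ne ham.2, ha⟩)
    rw [Finset.card_insert_of_notMem ha]
    convert this using 1
    ext; simp

/-- Vertices `v` with `x → v → y` can be added to a path from `x` to `y`. -/
theorem IsTournament.exists_absorb (hT : T.IsTournament) {x y : V} {l : List V}
    (hc : (x :: (l ++ [y])).IsChain T.Adj) (hnd : l.Nodup) (F : Finset V)
    (hF : F ⊆ T.between x y) (hFl : ∀ v ∈ F, v ∉ l) :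
    ∃ l' : List V, (x :: (l' ++ [y])).IsChain T.Adj ∧ l'.Nodup ∧
      ∀ v, v ∈ l' ↔ v ∈ l ∨ v ∈ F := by
  induction F using Finset.induction_on with
  | empty => exact ⟨l, hc, hnd, by simp⟩
  | insert r F hr ih =>
    obtain ⟨l₁, h1, h2, h3⟩ := ih (fun v hv => hF (Finset.mem_insert_of_mem hv))
      (fun v hv => hFl v (Finset.mem_insert_of_mem hv))
    have hrm := mem_between.1 (hF (Finset.mem_insert_self r F))
    have hrl : r ∉ l₁ := fun h => ((h3 r).1 h).elim (hFl r (Finset.mem_insert_self r F)) hr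
    have hry := hT.ne hrm.2
    obtain ⟨l₂, h4, h5, h6⟩ := hT.exists_insert_cons (r := r) (l₁ ++ [y]) x h1 hrm.1
      ⟨y, by simp, hrm.2⟩ (by simp [hrl, hry])
    rcases List.eq_nil_or_concat l₂ with rfl | ⟨l₃, b, rfl⟩
    · simpa using h5.length_eq
    rw [List.concat_eq_append] at h4 h5 h6
    have hb : b = y := by
      rw [← List.cons_append, ← List.cons_append, List.getLast?_append, List.getLast?_append] at h6
      simpa using h6
    subst hb
    have h7 : l₃.Perm (r :: l₁) := by
      rw [← List.cons_append] at h5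
      exact (List.perm_append_right_iff [b]).1 h5
    refine ⟨l₃, h4, h7.nodup_iff.2 (List.nodup_cons.2 ⟨hrl, h2⟩), fun v => ?_⟩
    rw [h7.mem_iff, List.mem_cons, h3, Finset.mem_insert]
    tauto

end

/-! ### Short paths, the long path and the container -/

section

open scoped Classical

variable {T : Digraph V} {x y : V}

/-- `la` and `lb` lead from `x` into `g` and from `h` to `y`, through distinct vertices of `M`. -/
def Connects (T : Digraph V) (x y : V) (M : Finset V) (g h : V) : Prop :=
  ∃ la lb : List V, (x :: (la ++ [g])).IsChain T.Adj ∧ (h :: (lb ++ [y])).IsChain T.Adj ∧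
    (la ++ lb).Nodup ∧ ∀ v ∈ la ++ lb, v ∈ M

theorem exists_path_of_connects {M : Finset V} {Z : Finset V} {A B : Set V}
    (hconn : ∀ g ∈ A, ∀ h ∈ B, Connects T x y M g h) {l : List V}
    (hl : IsTournament.IsPathFromTo T Z A B l) (hZM : Disjoint Z M) :
    ∃ l' : List V, (x :: (l' ++ [y])).IsChain T.Adj ∧ l'.Nodup ∧ (∀ v ∈ l, v ∈ l') ∧
      ∀ v ∈ l', v ∈ l ∨ v ∈ M := by
  obtain ⟨g, hgA, hg⟩ := hl.head
  obtain ⟨h, hhB, hh⟩ := hl.last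
  obtain ⟨la, lb, h1, h2, h3, h4⟩ := hconn g hgA h hhB
  refine ⟨la ++ l ++ lb, ?_, ?_, fun v hv => by simp [hv], fun v hv => ?_⟩
  · have e : x :: (la ++ l ++ lb ++ [y]) = ((x :: la) ++ l) ++ (lb ++ [y]) := by simp
    rw [← List.cons_append, List.isChain_append] at h1
    rw [List.isChain_cons] at h2
    rw [e, List.isChain_append, List.isChain_append]
    refine ⟨⟨h1.1, hl.chain, ?_⟩, h2.2, ?_⟩
    · simpa [hg] using h1.2.2
    · rw [List.getLast?_append, hh]
      simpa using h2.1
  · have hp : (l ++ (la ++ lb)).Perm (la ++ l ++ lb) := by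
      rw [← List.append_assoc]
      exact List.perm_append_comm.append_right lb
    rw [← hp.nodup_iff, List.nodup_append]
    refine ⟨hl.nodup, h3, ?_⟩
    rintro a ha b hb rfl
    exact Finset.disjoint_left.1 hZM (hl.subset a ha) (h4 a hb)
  · simp only [List.mem_append] at hv
    rcases hv with (hv | hv) | hv
    · exact Or.inr (h4 v (by simp [hv]))
    · exact Or.inl hv
    · exact Or.inr (h4 v (by simp [hv]))

variable [Fintype V] {n k t : ℕ}

/-- Single inner vertices and arcs from `commonOut` to `commonIn` give many short paths. -/
theorem IsTournament.exists_short_paths (hT : T.IsTournament) (hxy : x ≠ y)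
    (hn : Fintype.card V = n) (hout : ∀ v, n ≤ 2 * T.outDeg v + k + 1)
    (hin : ∀ v, n ≤ 2 * T.inDeg v + k + 1)
    (hq : (T.between y x).card ≤ (T.between x y).card) (h : 6 * t + 5 * k ≤ n) (ht : 1 ≤ t)
    {I : Finset V} (hI : I ⊆ T.between x y) (j : ℕ)
    (hj : j = 0 ∨ j + (T.between x y).card ≤ t + 1) :
    ∃ S ⊆ T.commonOut x y, ∃ U ⊆ T.commonIn x y, S.card = j ∧ U.card = j ∧
      T.HasPathSystem x y (I.card + j) (I ∪ (S ∪ U)) := by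
  induction j with
  | zero =>
    exact ⟨∅, by simp, ∅, by simp, by simp, by simp, by
      simpa using hT.hasPathSystem_between hxy I hI⟩
  | succ j ih =>
    obtain ⟨S, hS, U, hU, hSc, hUc, hsys⟩ := ih (by omega)
    have h1 := hT.card_eq hxy
    have h2 := hT.le_card_between_add_commonIn hin hq hxy
    have h3 := hT.le_card_between_add_commonOut hout hq hxy
    have hKc := Finset.card_sdiff_add_card_eq_card hS
    have hK : (T.commonOut x y \ S).Nonempty := by
      rw [← Finset.card_pos]
      omega
    obtain ⟨v, hv, hle⟩ := hT.exists_le_card_out hK hout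
    rw [Finset.mem_sdiff] at hv
    have hv1 := mem_commonOut.1 hv.1
    obtain ⟨u, hu, huU, hvu⟩ : ∃ u ∈ T.commonIn x y, u ∉ U ∧ T.Adj v u := by
      by_contra hno
      push Not at hno
      have hsub : (Finset.univ.filter fun u => T.Adj v u ∧ u ∉ T.commonOut x y \ S) ⊆
          (S ∪ U) ∪ (T.between x y ∪ T.between y x) := by
        intro u hu
        simp only [Finset.mem_filter, Finset.mem_univ, true_and, Finset.mem_sdiff, not_and,
          not_not] at hu
        have := hT.cover (x := x) (y := y) (v := u)
          (by rintro rfl; exact hT.asymm hv1.1 hu.1) (by rintro rfl; exact hT.asymm hv1.2 hu.1)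
        have := hno u
        have := hu.2
        simp only [Finset.mem_union]
        tauto
      -- With q = |Q|, r = |R|, o = |O|, this gives n ≤ 2(2j + q + r) + k + o - j. The bound on q +
      -- |C| gives 2(r + o) ≤ n + k - 3, so n ≤ 6j + 4q + 2r + 3k - 3. As r ≤ q and j + q ≤ t, this
      -- is less than 6t + 3k.
      have hc1 := Finset.card_le_card hsub
      have hc2 := Finset.card_union_le (S ∪ U) (T.between x y ∪ T.between y x)
      have hc3 := Finset.card_union_le S U
      have hc4 := Finset.card_union_le (T.between x y) (T.between y x)
      omega
    have hu1 := mem_commonIn.1 hu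
    have hvI : v ∉ I := fun h => hT.asymm hv1.2 (mem_between.1 (hI h)).2
    have huI : u ∉ I := fun h => hT.asymm hu1.1 (mem_between.1 (hI h)).1
    have hvU : v ∉ U := fun h => hT.asymm hv1.1 (mem_commonIn.1 (hU h)).1
    have huS : u ∉ S := fun h => hT.asymm hu1.1 (mem_commonOut.1 (hS h)).1
    have hsys' := hsys.succ hxy (l := [v, u]) (by simp)
      (by simp [List.isChain_cons_cons, hv1.1, hvu, hu1.2]) (by simpa using hT.ne hvu) (by
        simp only [List.mem_cons, List.not_mem_nil, or_false, Finset.mem_union, not_or]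
        rintro z (rfl | rfl)
        · exact ⟨(hT.ne hv1.1).symm, (hT.ne hv1.2).symm, hvI, hv.2, hvU⟩
        · exact ⟨hT.ne hu1.1, hT.ne hu1.2, huI, huS, huU⟩)
    refine ⟨insert v S, Finset.insert_subset hv.1 hS, insert u U, Finset.insert_subset hu hU,
      ?_, ?_, ?_⟩
    · rw [Finset.card_insert_of_notMem hv.2, hSc]
    · rw [Finset.card_insert_of_notMem huU, hUc]
    · have e : I ∪ (insert v S ∪ insert u U) = I ∪ (S ∪ U) ∪ [v, u].toFinset := by
        clear * -
        ext z
        simp only [Finset.mem_union, Finset.mem_insert, List.mem_toFinset, List.mem_cons,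
          List.not_mem_nil, or_false]
        tauto
      rw [e]
      exact hsys'

theorem connects_of_or {M : Finset V} (hM : M ⊆ T.between x y) {g h : V}
    (hg : T.Adj x g ∧ T.Adj h y ∨ T.Adj x g ∧ (∃ b ∈ M, T.Adj h b) ∨
      (∃ a ∈ M, T.Adj a g) ∧ T.Adj h y ∨ ∃ a ∈ M, ∃ b ∈ M, a ≠ b ∧ T.Adj a g ∧ T.Adj h b) :
    Connects T x y M g h := by
  rcases hg with ⟨h1, h2⟩ | ⟨h1, b, hb, h2⟩ | ⟨⟨a, ha, h1⟩, h2⟩ | ⟨a, ha, b, hb, hab, h1, h2⟩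
  · exact ⟨[], [], by simpa, by simpa, by simp, by simp⟩
  · exact ⟨[], [b], by simpa, by simpa [h2] using (mem_between.1 (hM hb)).2, by simp, by simpa⟩
  · exact ⟨[a], [], by simpa [h1] using (mem_between.1 (hM ha)).1, by simpa, by simp, by simpa⟩
  · exact ⟨[a], [b], by simpa [h1] using (mem_between.1 (hM ha)).1,
      by simpa [h2] using (mem_between.1 (hM hb)).2, by simpa, by simp [ha, hb]⟩

/-- The vertices of `between y x` can be divided into possible starts and possible ends of a
path that is to be connected to `x` and `y` through `M`. -/
theorem IsTournament.exists_starts_ends (hT : T.IsTournament) {M : Finset V}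
    (hM : M ⊆ T.between x y) (hc : 2 ≤ M.card ∨ (T.between y x).card ≤ M.card) :
    ∃ A B : Set V, (∀ v ∈ T.commonOut x y, v ∈ A) ∧ (∀ v ∈ T.commonIn x y, v ∈ B) ∧
      (∀ v ∈ T.between y x, v ∈ A ∨ v ∈ B) ∧
      (∀ v, v ∉ A → (M.filter fun a => T.Adj a v).card ≤ 1) ∧
      (∀ v, v ∉ B → (M.filter fun b => T.Adj v b).card ≤ 1) ∧
      ∀ g ∈ A, ∀ h ∈ B, Connects T x y M g h := by
  by_cases h2 : 2 ≤ M.card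
  -- The definition is asymmetric: an end needs two out-neighbours in `M`, so that one remains after
  -- the start has used `a`. A vertex of R that is not in A dominates all of `M`, hence has two.
  · refine ⟨{v | T.Adj x v ∨ ∃ a ∈ M, T.Adj a v},
      {v | T.Adj v y ∨ 2 ≤ (M.filter fun b => T.Adj v b).card}, ?_, ?_, ?_, ?_, ?_, ?_⟩
    · exact fun v hv => Or.inl (mem_commonOut.1 hv).1
    · exact fun v hv => Or.inl (mem_commonIn.1 hv).2
    · intro v hv
      rw [or_iff_not_imp_left]
      intro hvA
      simp only [Set.mem_ofPred_eq, not_or, not_exists, not_and] at hvA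
      refine Or.inr ?_
      rwa [Finset.filter_true_of_mem]
      intro b hb
      refine hT.adj_of_not_adj ?_ (hvA.2 b hb)
      rintro rfl
      exact hvA.1 (mem_between.1 (hM hb)).1
    · intro v hv
      simp only [Set.mem_ofPred_eq, not_or, not_exists, not_and] at hv
      rw [Finset.filter_false_of_mem hv.2]
      simp
    · intro v hv
      simp only [Set.mem_ofPred_eq, not_or] at hv
      omega
    · intro g hg h hh
      apply connects_of_or hM
      rcases hg with hg | ⟨a, ha, hg⟩ <;> rcases hh with hh | hh
      · exact Or.inl ⟨hg, hh⟩
      · obtain ⟨b, hb⟩ := Finset.card_pos.1 (by omega : 0 < (M.filter fun b => T.Adj h b).card)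
        exact Or.inr (Or.inl ⟨hg, b, Finset.mem_filter.1 hb⟩)
      · exact Or.inr (Or.inr (Or.inl ⟨⟨a, ha, hg⟩, hh⟩))
      · obtain ⟨b, hb, hba⟩ := Finset.exists_mem_ne hh a
        rw [Finset.mem_filter] at hb
        exact Or.inr (Or.inr (Or.inr ⟨a, ha, b, hb.1, hba.symm, hg, hb.2⟩))
  · have hf : ∀ p : V → Prop, (M.filter p).card ≤ 1 := fun p =>
      (Finset.card_filter_le _ _).trans (by omega)
    rcases (T.between y x).eq_empty_or_nonempty with hN | ⟨r, hr⟩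
    · exact ⟨{v | T.Adj x v}, {v | T.Adj v y}, fun v hv => (mem_commonOut.1 hv).1,
        fun v hv => (mem_commonIn.1 hv).2, by simp [hN], fun _ _ => hf _, fun _ _ => hf _,
        fun g hg h hh => connects_of_or hM (Or.inl ⟨hg, hh⟩)⟩
    -- Here R = {r} and `M` has one vertex `a`. The arc between them decides whether `r` may start
    -- or end, so `a` is never needed twice.
    · have hpos := Finset.card_pos.2 ⟨r, hr⟩
      obtain ⟨r', hr'⟩ := Finset.card_eq_one.1 (by omega : (T.between y x).card = 1)
      obtain rfl : r = r' := by simpa [hr'] using hr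
      obtain ⟨a, ha⟩ := Finset.card_pos.1 (by omega : 0 < M.card)
      have har : a ≠ r := by
        rintro rfl
        exact hT.asymm (mem_between.1 (hM ha)).1 (mem_between.1 hr).2
      rcases hT.adj_or_adj har with har | hra
      · refine ⟨{v | T.Adj x v ∨ v = r}, {v | T.Adj v y}, fun v hv => Or.inl (mem_commonOut.1 hv).1,
          fun v hv => (mem_commonIn.1 hv).2, by simp [hr'], fun _ _ => hf _, fun _ _ => hf _, ?_⟩
        rintro g (hg | rfl) h hh
        · exact connects_of_or hM (Or.inl ⟨hg, hh⟩)
        · exact connects_of_or hM (Or.inr (Or.inr (Or.inl ⟨⟨a, ha, har⟩, hh⟩)))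
      · refine ⟨{v | T.Adj x v}, {v | T.Adj v y ∨ v = r}, fun v hv => (mem_commonOut.1 hv).1,
          fun v hv => Or.inl (mem_commonIn.1 hv).2, by simp [hr'], fun _ _ => hf _, fun _ _ => hf _,
          ?_⟩
        rintro g hg h (hh | rfl)
        · exact connects_of_or hM (Or.inl ⟨hg, hh⟩)
        · exact connects_of_or hM (Or.inr (Or.inl ⟨hg, a, ha, hra⟩))

/-- If at most as many vertices lie between `y` and `x` as between `x` and `y`, then the vertices
are covered by `w` internally disjoint paths from `x` to `y`. -/
theorem IsTournament.exists_spanning_container (hT : T.IsTournament) (hxy : x ≠ y)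
    (hn : Fintype.card V = n) (hout : ∀ v, n ≤ 2 * T.outDeg v + k + 1)
    (hin : ∀ v, n ≤ 2 * T.inDeg v + k + 1)
    (hq : (T.between y x).card ≤ (T.between x y).card) (h : 6 * t + 5 * k ≤ n)
    {w : ℕ} (hw : 1 ≤ w) (hwt : w ≤ t) :
    ∃ P, T.IsDirectedSpanningContainer w x y P := by
  have h1 := hT.card_eq hxy
  have h2 := hT.le_card_between_add_commonIn hin hq hxy
  have h3 := hT.le_card_between_add_commonOut hout hq hxy
  -- Two vertices of Q are held back. If |Q| < 2, truncated subtraction makes `I` empty, and |R| ≤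
  -- |Q| gives the second alternative needed by `exists_starts_ends`. Arcs from O to C are used only
  -- if `w - 1` exceeds |Q| - 2, whence j + |Q| ≤ t + 1.
  obtain ⟨I, hI, hIc⟩ := Finset.exists_subset_card_eq
    (min_le_right (w - 1) ((T.between x y).card - 2) |>.trans (Nat.sub_le _ _))
  obtain ⟨S, hS, U, hU, hSc, hUc, hsys⟩ := hT.exists_short_paths hxy hn hout hin hq h
    (by omega) hI (w - 1 - I.card) (by omega)
  set j := w - 1 - I.card with hj
  set M := T.between x y \ I with hM
  have hMc : M.card + I.card = (T.between x y).card :=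
    Finset.card_sdiff_add_card_eq_card hI
  have hMs : M ⊆ T.between x y := Finset.sdiff_subset
  obtain ⟨A, B, hA, hB, hAB, hA1, hB1, hconn⟩ := hT.exists_starts_ends hMs (by omega)
  set Z := (T.between y x ∪ T.commonOut x y ∪ T.commonIn x y) \ (S ∪ U) with hZ
  have hZM : ∀ v ∈ Z, v ∉ T.between x y := by
    intro v hv
    simp only [hZ, Finset.mem_sdiff, Finset.mem_union, mem_between, mem_commonOut, mem_commonIn]
      at hv ⊢
    have h4 := fun h : T.Adj x v => hT.asymm h
    have h5 := fun h : T.Adj y v => hT.asymm h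
    tauto
  have hcov : ∀ v, v ≠ x → v ≠ y → v ∈ I ∪ (S ∪ U) ∨ v ∈ M ∨ v ∈ Z := by
    intro v hx hy
    have := hT.cover hx hy
    simp only [hM, hZ, Finset.mem_sdiff, Finset.mem_union]
    tauto
  have hZne : Z.Nonempty := by
    have hx : T.inDeg x ≤ (insert y (T.between y x ∪ T.commonIn x y)).card := by
      refine Finset.card_le_card fun v hv => ?_
      simp only [Finset.mem_filter, Finset.mem_univ, true_and, Finset.mem_insert, Finset.mem_union,
        mem_between, mem_commonIn] at hv ⊢
      rw [or_iff_not_imp_left]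
      intro hvy
      have := hT.adj_or_adj hvy
      tauto
    have := hin x
    have := Finset.card_insert_le y (T.between y x ∪ T.commonIn x y)
    obtain ⟨v, hv, hvU⟩ := Finset.exists_mem_notMem_of_card_lt_card
      (by omega : U.card < (T.between y x ∪ T.commonIn x y).card)
    have hvx : T.Adj v x := by
      simp only [Finset.mem_union, mem_between, mem_commonIn] at hv
      tauto
    have hvS : v ∉ S := fun h => hT.asymm hvx (mem_commonOut.1 (hS h)).1
    refine ⟨v, ?_⟩
    simp only [hZ, Finset.mem_sdiff, Finset.mem_union] at hv ⊢
    tauto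
  -- This bounds the neighbours outside a closed set: the short paths, one of `x` and `y` as `z`,
  -- and at most one vertex of `M` as `s`.
  have hIu : ∀ s : Finset V, s.card ≤ 1 →
      ∀ z : V, (insert z (I ∪ (S ∪ U) ∪ s)).card ≤ I.card + 2 * j + 2 := by
    intro s hs z
    have := Finset.card_insert_le z (I ∪ (S ∪ U) ∪ s)
    have := Finset.card_union_le (I ∪ (S ∪ U)) s
    have := Finset.card_union_le I (S ∪ U)
    have := Finset.card_union_le S U
    omega
  obtain ⟨l, hl, hlZ⟩ : ∃ l, IsPathFromTo T Z A B l ∧ ∀ v ∈ Z, v ∈ l := by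
    apply hT.exists_hamiltonian_path hZne
    · intro v hv
      simp only [hZ, Finset.mem_sdiff, Finset.mem_union] at hv
      rcases hv.1 with (hv | hv) | hv
      · exact hAB v hv
      · exact Or.inl (hA v hv)
      · exact Or.inr (hB v hv)
    · intro K hKZ hK hclosed
      by_contra hno
      push Not at hno
      obtain ⟨v, hv, hle⟩ := hT.exists_le_card_out hK hout
      have hKsub : K ⊆ T.between y x ∪ (T.commonOut x y \ S) := by
        intro u hu
        have hu1 := hKZ hu
        have hu2 := hno u hu
        have hu3 := hB u
        simp only [hZ, Finset.mem_sdiff, Finset.mem_union] at hu1 ⊢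
        tauto
      have hyv : T.Adj y v := by
        have := hKsub hv
        simp only [Finset.mem_sdiff, Finset.mem_union, mem_between, mem_commonOut] at this
        tauto
      have hsub : (Finset.univ.filter fun u => T.Adj v u ∧ u ∉ K) ⊆
          insert x (I ∪ (S ∪ U) ∪ M.filter fun b => T.Adj v b) := by
        intro u hu
        simp only [Finset.mem_filter, Finset.mem_univ, true_and] at hu
        rw [Finset.mem_insert, or_iff_not_imp_left]
        intro hux
        rcases hcov u hux (by rintro rfl; exact hT.asymm hyv hu.1) with h | h | h
        · exact Finset.mem_union_left _ h
        · exact Finset.mem_union_right _ (Finset.mem_filter.2 ⟨h, hu.1⟩)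
        · exact absurd hu.1 (hclosed v hv u h hu.2)
      -- With i = |I|: n ≤ 2(i + 2j + 2) + k + |R| + |O| - j and 2(|R| + |O|) ≤ n + k - 3 give n ≤
      -- 4i + 6j + 3k + 5. As i + j = w - 1 ≤ t - 1, this is at most 6t + 3k - 1.
      have hc1 := (Finset.card_le_card hsub).trans (hIu _ (hB1 v (hno v hv)) x)
      have hc2 := (Finset.card_le_card hKsub).trans (Finset.card_union_le _ _)
      have hc3 := Finset.card_sdiff_add_card_eq_card hS
      omega
    · intro K hKZ hK hclosed
      by_contra hno
      push Not at hno
      obtain ⟨v, hv, hle⟩ := hT.exists_le_card_in hK hin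
      have hKsub : K ⊆ T.between y x ∪ (T.commonIn x y \ U) := by
        intro u hu
        have hu1 := hKZ hu
        have hu2 := hno u hu
        have hu3 := hA u
        simp only [hZ, Finset.mem_sdiff, Finset.mem_union] at hu1 ⊢
        tauto
      have hvx : T.Adj v x := by
        have := hKsub hv
        simp only [Finset.mem_sdiff, Finset.mem_union, mem_between, mem_commonIn] at this
        tauto
      have hsub : (Finset.univ.filter fun u => T.Adj u v ∧ u ∉ K) ⊆
          insert y (I ∪ (S ∪ U) ∪ M.filter fun a => T.Adj a v) := by
        intro u hu
        simp only [Finset.mem_filter, Finset.mem_univ, true_and] at hu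
        rw [Finset.mem_insert, or_iff_not_imp_left]
        intro huy
        rcases hcov u (by rintro rfl; exact hT.asymm hvx hu.1) huy with h | h | h
        · exact Finset.mem_union_left _ h
        · exact Finset.mem_union_right _ (Finset.mem_filter.2 ⟨h, hu.1⟩)
        · exact absurd hu.1 (hclosed v hv u h hu.2)
      have hc1 := (Finset.card_le_card hsub).trans (hIu _ (hA1 v (hno v hv)) y)
      have hc2 := (Finset.card_le_card hKsub).trans (Finset.card_union_le _ _)
      have hc3 := Finset.card_sdiff_add_card_eq_card hU
      omega
  obtain ⟨l₁, h4, h5, h6, h7⟩ := exists_path_of_connects hconn hl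
    (Finset.disjoint_left.2 fun v hv h => hZM v hv (hMs h))
  -- The connection uses at most some of `M`; the rest of it is inserted.
  obtain ⟨l₂, h8, h9, h10⟩ := hT.exists_absorb h4 h5 (M.filter (· ∉ l₁))
    ((Finset.filter_subset _ _).trans hMs) (fun v hv => (Finset.mem_filter.1 hv).2)
  have hl₂ : ∀ v, v ∈ l₂ ↔ v ∈ Z ∨ v ∈ M := by
    intro v
    rw [h10, Finset.mem_filter]
    constructor
    · rintro (h | h)
      · exact (h7 v h).imp_left (hl.subset v)
      · exact Or.inr h.1
    · rintro (h | h)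
      · exact Or.inl (h6 v (hlZ v h))
      · by_cases hv : v ∈ l₁
        · exact Or.inl hv
        · exact Or.inr ⟨h, hv⟩
  have hfinal := hsys.succ hxy (l := l₂) (by
      obtain ⟨v, hv⟩ := hZne
      exact List.ne_nil_of_mem ((hl₂ v).2 (Or.inl hv))) h8 h9 (by
      intro z hz
      rw [hl₂] at hz
      have hz1 : z ∉ I ∪ (S ∪ U) := by
        rcases hz with hz | hz
        · have := hZM z hz
          have := @hI z
          simp only [hZ, Finset.mem_sdiff] at hz
          simp only [Finset.mem_union] at hz ⊢
          tauto
        · have hzM := mem_between.1 (hMs hz)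
          have hzS : z ∉ S := fun h => hT.asymm hzM.2 (mem_commonOut.1 (hS h)).2
          have hzU : z ∉ U := fun h => hT.asymm hzM.1 (mem_commonIn.1 (hU h)).1
          simp only [hM, Finset.mem_sdiff] at hz
          simp only [Finset.mem_union]
          tauto
      refine ⟨?_, ?_, hz1⟩
      · rintro rfl
        simp [hZ, hM, hT.irrefl] at hz
      · rintro rfl
        simp [hZ, hM, hT.irrefl] at hz)
  have hwj : I.card + j + 1 = w := by omega
  rw [hwj] at hfinal
  refine hfinal.exists_container hw fun z hx hy => ?_
  rw [Finset.mem_union, List.mem_toFinset, hl₂]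
  have := hcov z hx hy
  tauto

end

end Digraph

open Digraph in
theorem mainTheorem1 {V : Type*} [Fintype V] (T : Digraph V) (hT : T.IsTournament)
    (n k t : ℕ) (hn : Fintype.card V = n) (hk : T.irregularity ≤ k) (ht : 2 ≤ t)
    (h : 6 * t + 5 * k ≤ n) :
    (t : ℕ∞) ≤ T.strongSpanningConnectivity := by
  have hirr : ∀ v, ((T.outDeg v : ℤ) - (T.inDeg v : ℤ)).natAbs ≤ k := fun v =>
    (Finset.le_sup (f := fun v => ((T.outDeg v : ℤ) - (T.inDeg v : ℤ)).natAbs)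
      (Finset.mem_univ v)).trans hk
  have hout : ∀ v, n ≤ 2 * T.outDeg v + k + 1 := fun v => by
    have := hirr v
    have := hT.outDeg_add_inDeg v
    omega
  have hin : ∀ v, n ≤ 2 * T.inDeg v + k + 1 := fun v => by
    have := hirr v
    have := hT.outDeg_add_inDeg v
    omega
  refine le_sSup ⟨t, rfl, fun w hw hwt x y hxy => ?_⟩
  -- The container runs in the direction with at least as many two-arc paths.
  rcases le_total (T.between y x).card (T.between x y).card with hq | hq
  · obtain ⟨P, hP⟩ := hT.exists_spanning_container hxy hn hout hin hq h hw hwt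
    exact ⟨P, Or.inl hP⟩
  · obtain ⟨P, hP⟩ := hT.exists_spanning_container hxy.symm hn hout hin hq h hw hwt
    exact ⟨P, Or.inr hP⟩
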